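/- Let $\kappa \in \{2,3,4,\ldots,\omega\}$. For a positive integer $n$, let $E_n=\{x_k=1,\ x_i+x_j=x_k,\ x_i\cdot x_j=x_k : i,j,k\in\{1,\ldots,n\}\}$, and let $f_\kappa(n)$ be the smallest non-negative integer $b$ such that every system $S\subseteq E_n$ which has a solution in non-negative integers $x_1,\ldots,x_n$ and has fewer than $\kappa$ such solutions has a solution in non-negative integers not greater than $b$. A set $\mathcal M\subseteq\mathbb N^n$ is said to have a $\kappa$-fold Diophantine representation if there are $m\in\mathbb N$ and a polynomial $W$ with integer coefficients such that, for all $a\in\mathbb N^n$, one has $a\in\mathcal M$ if and only if $W(a,x)=0$ for some $x\in\mathbb N^m$, and such that, for every $a\in\mathbb N^n$, the equation $W(a,x)=0$ has fewer than $\kappa$ solutions $x\in\mathbb N^m$. Consider the following three statements. (a) There is an algorithm which takes as input a Diophantine equation $D$ (a polynomial equation with integer coefficients), always terminates with the answer YES or NO, and whose answer correctly indicates whether $D$ has a solution in non-negative integers whenever $D$ has fewer than $\kappa$ solutions in non-negative integers. (b) The function $f_\kappa$ is majorized by a computable function, that is, there is a computable function $g$ with $f_\kappa(n)\le g(n)$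 for all positive integers $n$. (c) For every $n$, every set $\mathcal M\subseteq\mathbb N^n$ that has a $\kappa$-fold Diophantine representation is computable. Then (a) is equivalent to (b), and (a) implies (c). -/

import Mathlib

open scoped Cardinal

namespace FoldDioph

/-- The set of solutions in non-negative integers of the Diophantine equation `D = 0`,
where `D` is a polynomial with integer coefficients. -/
def Sol {σ : Type} (D : MvPolynomial σ ℤ) : Set (σ → ℕ) :=
  {x | MvPolynomial.eval (fun i => (x i : ℤ)) D = 0}

/-! ### Diophantine equations as inputs of algorithms -/

/-- A Diophantine equation as it is written down for an algorithm: the number `p` of unknowns and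
a finite list of monomials, each given by its integer coefficient and the list of its exponents. -/
abbrev EqCode : Type := ℕ × List (ℤ × List ℕ)

/-- The polynomial in `p` unknowns that is written down in a code: the sum of the monomials
`c * x₀ ^ e₀ * ⋯ * x_{p-1} ^ e_{p-1}` (exponents that are not listed are `0`,
exponents beyond the last unknown are ignored). -/
noncomputable def EqCode.poly (c : EqCode) : MvPolynomial (Fin c.1) ℤ :=
  (c.2.map fun t => MvPolynomial.C t.1 * ∏ i : Fin c.1, MvPolynomial.X i ^ t.2.getD i 0).sum

/-- Every polynomial with integer coefficients is written down by some code. -/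
theorem EqCode.exists_poly_eq {p : ℕ} (D : MvPolynomial (Fin p) ℤ) :
    ∃ L : List (ℤ × List ℕ), EqCode.poly (p, L) = D := by
  induction D using MvPolynomial.monomial_add_induction_on with
  | C a =>
    refine ⟨[(a, [])], ?_⟩
    simp [EqCode.poly]
  | monomial_add a b f _ _ ih =>
    obtain ⟨L, hL⟩ := ih
    refine ⟨(b, List.ofFn fun i => a i) :: L, ?_⟩
    rw [← hL]
    simp only [EqCode.poly, List.map_cons, List.sum_cons]
    congr 1
    rw [MvPolynomial.monomial_eq, Finsupp.prod_fintype _ _ (by simp)]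
    simp [List.getD_eq_getElem?_getD]

/-- There is an algorithm that halts on every Diophantine equation `D` with the answer YES or NO,
and whose answer tells correctly whether `D` has a solution in non-negative integers whenever `D`
has fewer than `κ` such solutions. -/
def SolvabilityDecidable (κ : Cardinal.{0}) : Prop :=
  ∃ A : EqCode → Bool, Computable A ∧
    ∀ D : EqCode, #(Sol D.poly) < κ → (A D = true ↔ (Sol D.poly).Nonempty)

/-! ### The systems of equations `S ⊆ E_n` and the function `f_κ` -/

/-- The elements of `E_n`: the equations `x_k = 1`, `x_i + x_j = x_k`, `x_i * x_j = x_k`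
in the unknowns `x_1, …, x_n`. -/
inductive E (n : ℕ) : Type
  | one (k : Fin n) : E n
  | add (i j k : Fin n) : E n
  | mul (i j k : Fin n) : E n

/-- The tuple `x` of non-negative integers satisfies the equation. -/
def E.Holds {n : ℕ} (x : Fin n → ℕ) : E n → Prop
  | .one k => x k = 1
  | .add i j k => x i + x j = x k
  | .mul i j k => x i * x j = x k

/-- The set of solutions in non-negative integers of a system `S ⊆ E_n`. -/
def SysSol {n : ℕ} (S : Set (E n)) : Set (Fin n → ℕ) :=
  {x | ∀ e ∈ S, e.Holds x}

/-- `b` is such that every system `S ⊆ E_n` that has a solution and has fewer than `κ` solutions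
in non-negative integers has a solution in non-negative integers not greater than `b`. -/
def IsSolutionBound (κ : Cardinal.{0}) (n b : ℕ) : Prop :=
  ∀ S : Set (E n), (SysSol S).Nonempty → #(SysSol S) < κ → ∃ x ∈ SysSol S, ∀ i, x i ≤ b

/-- `f κ n` is the smallest `b` with `IsSolutionBound κ n b`; such a `b` exists by
`exists_isSolutionBound`. -/
noncomputable def f (κ : Cardinal.{0}) (n : ℕ) : ℕ :=
  sInf {b | IsSolutionBound κ n b}

instance (n : ℕ) : Finite (E n) := by
  let φ : Fin n ⊕ (Fin n × Fin n × Fin n) ⊕ (Fin n × Fin n × Fin n) → E n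
    | .inl k => .one k
    | .inr (.inl (i, j, k)) => .add i j k
    | .inr (.inr (i, j, k)) => .mul i j k
  refine Finite.of_surjective φ ?_
  rintro (k | ⟨i, j, k⟩ | ⟨i, j, k⟩)
  · exact ⟨.inl k, rfl⟩
  · exact ⟨.inr (.inl (i, j, k)), rfl⟩
  · exact ⟨.inr (.inr (i, j, k)), rfl⟩

theorem exists_isSolutionBound (κ : Cardinal.{0}) (n : ℕ) : ∃ b, IsSolutionBound κ n b := by
  classical
  have h : ∀ S : Set (E n), ∃ b : ℕ,
      (SysSol S).Nonempty → ∃ x ∈ SysSol S, ∀ i, x i ≤ b := by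
    intro S
    by_cases hS : (SysSol S).Nonempty
    · obtain ⟨x, hx⟩ := hS
      exact ⟨∑ i, x i, fun _ => ⟨x, hx, fun i =>
        Finset.single_le_sum (f := x) (fun _ _ => Nat.zero_le _) (Finset.mem_univ i)⟩⟩
    · exact ⟨0, fun h => absurd h hS⟩
  choose b hb using h
  obtain ⟨B, hB⟩ := (Set.finite_range b).bddAbove
  refine ⟨B, fun S hS _ => ?_⟩
  obtain ⟨x, hx, hle⟩ := hb S hS
  exact ⟨x, hx, fun i => (hle i).trans (hB ⟨S, rfl⟩)⟩

/-- `f κ n` is the smallest solution bound. -/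
theorem f_isLeast (κ : Cardinal.{0}) (n : ℕ) : IsLeast {b | IsSolutionBound κ n b} (f κ n) :=
  ⟨Nat.sInf_mem (exists_isSolutionBound κ n), fun _ hb => Nat.sInf_le hb⟩

/-- A function of a positive integer is majorized by a computable function. -/
def MajorizedByComputable (F : ℕ → ℕ) : Prop :=
  ∃ g : ℕ → ℕ, Computable g ∧ ∀ n, 1 ≤ n → F n ≤ g n

/-! ### `κ`-fold Diophantine representations -/

/-- The set `M ⊆ ℕ^n` has a `κ`-fold Diophantine representation: there is a polynomial
`W(a_1, …, a_n, x_1, …, x_m)` with integer coefficients such that `a ∈ M` if and only if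
`W(a, x) = 0` for some `x ∈ ℕ^m`, and, for every `a ∈ ℕ^n`, fewer than `κ` tuples `x ∈ ℕ^m`
satisfy `W(a, x) = 0`. -/
def HasFoldRepresentation (κ : Cardinal.{0}) {n : ℕ} (M : Set (Fin n → ℕ)) : Prop :=
  ∃ (m : ℕ) (W : MvPolynomial (Fin n ⊕ Fin m) ℤ),
    (∀ a : Fin n → ℕ, a ∈ M ↔ ∃ x : Fin m → ℕ, Sum.elim a x ∈ Sol W) ∧
    ∀ a : Fin n → ℕ, #{x : Fin m → ℕ | Sum.elim a x ∈ Sol W} < κ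

end FoldDioph

/-! The proof passes between systems and single equations without changing the number of solutions.

From (a) to (b): a system `S ⊆ E_n` has the same solutions as one equation, the sum of the squares
of its defects (`exists_sol_systemCode_eq`). For each `n` there are finitely many such equations,
listed computably. The algorithm is run on each of them. A YES is always true, because an equation
without solutions has `0 < κ` of them, so after a YES the search for a box containing a solution
ends. The sum of all box sizes found is a computable bound for `f κ n`.

From (b) to (a): an equation is unfolded into a system whose auxiliary unknowns are uniquely
determined and whose number of unknowns is computable (`EqCode.exists_system`). Restriction is a
bijection between the solution sets, so having fewer than `κ` solutions carries over. The majorant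
at that number of unknowns then gives a box that need only be searched.

From (a) to (c): `W(a, ·)` is an equation computed from `a` (`exists_primrec_section`) with fewer
than `κ` solutions, so the algorithm answers it correctly. -/

namespace FoldDioph

/-! ### Computability of integer parts, finite sums and products, and unbounded search. -/

section Recursion

variable {α β : Type} [Primcodable α] [Primcodable β]

/-- Integers are encoded by parity: `n` has code `2 * n` and `-(n + 1)` has code `2 * n + 1`. -/
theorem primrec_int_toNat : Primrec Int.toNat := by
  have h : Primrec fun c : ℤ => if (Encodable.encode c) % 2 = 0 then Encodable.encode c / 2 else 0 :=
    Primrec.ite (Primrec.eq.comp (Primrec.nat_mod.comp Primrec.encode (Primrec.const 2))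
      (Primrec.const 0)) (Primrec.nat_div.comp Primrec.encode (Primrec.const 2)) (Primrec.const 0)
  refine h.of_eq fun c => ?_
  rcases c with n | n
  · have : Encodable.encode (Int.ofNat n) = 2 * n := rfl
    rw [this]
    simp
  · have : Encodable.encode (Int.negSucc n) = 2 * n + 1 := rfl
    rw [this]
    split <;> omega

theorem primrec_int_neg_toNat : Primrec fun c : ℤ => (-c).toNat := by
  have h : Primrec fun c : ℤ =>
      if (Encodable.encode c) % 2 = 0 then 0 else Encodable.encode c / 2 + 1 :=
    Primrec.ite (Primrec.eq.comp (Primrec.nat_mod.comp Primrec.encode (Primrec.const 2))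
      (Primrec.const 0)) (Primrec.const 0)
      (Primrec.succ.comp (Primrec.nat_div.comp Primrec.encode (Primrec.const 2)))
  refine h.of_eq fun c => ?_
  rcases c with n | n
  · have : Encodable.encode (Int.ofNat n) = 2 * n := rfl
    rw [this]
    simp
  · have : Encodable.encode (Int.negSucc n) = 2 * n + 1 := rfl
    rw [this]
    split <;> omega

theorem primrec_nat_pow : Primrec₂ ((· ^ ·) : ℕ → ℕ → ℕ) :=
  Primrec₂.unpaired'.1 Nat.Primrec.pow

theorem primrec_list_sum_map {f : α → List β} {g : α → β → ℕ} (hf : Primrec f)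
    (hg : Primrec₂ g) : Primrec fun a => ((f a).map (g a)).sum := by
  have h : Primrec fun a => (f a).foldr (fun b s => g a b + s) 0 :=
    Primrec.list_foldr (h := fun a p => g a p.1 + p.2) hf (Primrec.const 0)
      (Primrec.nat_add.comp (hg.comp Primrec.fst (Primrec.fst.comp Primrec.snd))
        (Primrec.snd.comp Primrec.snd))
  refine h.of_eq fun a => ?_
  induction f a with
  | nil => rfl
  | cons b l ih => simp [ih]

theorem primrec_list_prod_map {f : α → List β} {g : α → β → ℕ} (hf : Primrec f)
    (hg : Primrec₂ g) : Primrec fun a => ((f a).map (g a)).prod := by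
  have h : Primrec fun a => (f a).foldr (fun b s => g a b * s) 1 :=
    Primrec.list_foldr (h := fun a p => g a p.1 * p.2) hf (Primrec.const 1)
      (Primrec.nat_mul.comp (hg.comp Primrec.fst (Primrec.fst.comp Primrec.snd))
        (Primrec.snd.comp Primrec.snd))
  refine h.of_eq fun a => ?_
  induction f a with
  | nil => rfl
  | cons b l ih => simp [ih]

theorem primrec_sum_fin {p : α → ℕ} {g : α → ℕ → ℕ} (hp : Primrec p) (hg : Primrec₂ g) :
    Primrec fun a => ∑ i : Fin (p a), g a i :=
  (primrec_list_sum_map (Primrec.list_range.comp hp) hg).of_eq fun a => by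
    rw [Fin.sum_univ_eq_sum_range (g a) (p a)]; rfl

theorem primrec_prod_fin {p : α → ℕ} {g : α → ℕ → ℕ} (hp : Primrec p) (hg : Primrec₂ g) :
    Primrec fun a => ∏ i : Fin (p a), g a i :=
  (primrec_list_prod_map (Primrec.list_range.comp hp) hg).of_eq fun a => by
    rw [Fin.prod_univ_eq_prod_range (g a) (p a)]; rfl

theorem computable_sum_range {F : α → ℕ → ℕ} {m : α → ℕ} (hF : Computable₂ F)
    (hm : Computable m) : Computable fun a => ∑ i ∈ Finset.range (m a), F a i := by
  have h := Computable.nat_rec (h := fun a (p : ℕ × ℕ) => p.2 + F a p.1) hm (Computable.const 0)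
    (Primrec.nat_add.to_comp.comp (Computable.snd.comp Computable.snd)
      (hF.comp Computable.fst (Computable.fst.comp Computable.snd)))
  refine h.of_eq fun a => ?_
  induction m a with
  | zero => rfl
  | succ k ih => rw [Finset.sum_range_succ, ← ih]

/-- Unbounded search that always succeeds is computable. -/
theorem exists_computable_search {p : α → ℕ → Bool} (hp : Computable₂ p)
    (h : ∀ a, ∃ n, p a n = true) : ∃ g : α → ℕ, Computable g ∧ ∀ a, p a (g a) = true := by
  refine ⟨fun a => Nat.find (h a), ?_, fun a => Nat.find_spec (h a)⟩
  refine Partrec.of_eq_tot (f := fun a => Nat.rfind fun n => Part.some (p a n))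
    (Partrec.rfind hp.partrec₂) fun a => ?_
  refine Nat.mem_rfind.2 ⟨Part.mem_some_iff.2 (Nat.find_spec (h a)).symm, fun {m} hm =>
    Part.mem_some_iff.2 ?_⟩
  simpa using (Nat.find_min (h a) hm)

end Recursion

/-! ### Bounded search for solutions -/

theorem mem_sol_poly_iff (c : EqCode) (x : Fin c.1 → ℕ) :
    x ∈ Sol c.poly ↔
      (c.2.map fun t => t.1 * ∏ i : Fin c.1, (x i : ℤ) ^ t.2.getD i 0).sum = 0 := by
  simp only [Sol, EqCode.poly, Set.mem_ofPred_eq, map_list_sum, List.map_map]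
  simp [Function.comp_def]

/-- The value at `x` of the part of the polynomial in which every coefficient `c` has been
replaced by the natural number `s c`. -/
def EqCode.part (s : ℤ → ℕ) (c : EqCode) (x : Fin c.1 → ℕ) : ℕ :=
  (c.2.map fun t => s t.1 * ∏ i : Fin c.1, x i ^ t.2.getD i 0).sum

/-- Writing each coefficient as positive part minus negative part and moving the latter across
leaves an equality in `ℕ`. This form serves both the primitive recursive test and the translation
into systems. -/
theorem mem_sol_poly_iff_part (c : EqCode) (x : Fin c.1 → ℕ) :
    x ∈ Sol c.poly ↔ c.part Int.toNat x = c.part (fun z => (-z).toNat) x := by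
  rw [mem_sol_poly_iff, ← Nat.cast_inj (R := ℤ)]
  -- The list is generalized while the number of unknowns stays fixed, since `x` depends on `c.1`.
  suffices h : ∀ L : List (ℤ × List ℕ),
      (L.map fun t => t.1 * ∏ i : Fin c.1, (x i : ℤ) ^ t.2.getD i 0).sum =
        ((L.map fun t => t.1.toNat * ∏ i : Fin c.1, x i ^ t.2.getD i 0).sum : ℕ) -
        ((L.map fun t => (-t.1).toNat * ∏ i : Fin c.1, x i ^ t.2.getD i 0).sum : ℕ) by
    rw [h, sub_eq_zero]; rfl
  intro L
  induction L with
  | nil => simp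
  | cons t L ih =>
    have ht : t.1 = (t.1.toNat : ℤ) - ((-t.1).toNat : ℤ) := by omega
    simp only [List.map_cons, List.sum_cons, Nat.cast_add, Nat.cast_mul, Nat.cast_prod,
      Nat.cast_pow]
    rw [ih]
    nth_rewrite 1 [ht]
    ring

/-- The `k`-th point of the box `[0, b]^p`: the digits of `k` in base `b + 1`. -/
def boxPoint (p b k : ℕ) (i : Fin p) : ℕ := k / (b + 1) ^ (i : ℕ) % (b + 1)

theorem exists_boxPoint_eq {p b : ℕ} {x : Fin p → ℕ} (hx : ∀ i, x i ≤ b) :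
    ∃ k < (b + 1) ^ p, boxPoint p b k = x := by
  let y : Fin p → Fin (b + 1) := fun i => ⟨x i, Nat.lt_succ_of_le (hx i)⟩
  refine ⟨finFunctionFinEquiv y, (finFunctionFinEquiv y).2, funext fun i => ?_⟩
  have h := congrArg Fin.val (congrFun (finFunctionFinEquiv.symm_apply_apply y) i)
  rwa [finFunctionFinEquiv_symm_apply_val] at h

/-- The equation has a solution in the box `[0, b]^p`. -/
def SolvableInBox (c : EqCode) (b : ℕ) : Prop := ∃ x ∈ Sol c.poly, ∀ i, x i ≤ b

theorem solvableInBox_iff (c : EqCode) (b : ℕ) :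
    SolvableInBox c b ↔ ∃ k < (b + 1) ^ c.1,
      c.part Int.toNat (boxPoint c.1 b k) = c.part (fun z => (-z).toNat) (boxPoint c.1 b k) := by
  simp only [← mem_sol_poly_iff_part]
  constructor
  · rintro ⟨x, hx, hb⟩
    obtain ⟨k, hk, rfl⟩ := exists_boxPoint_eq hb
    exact ⟨k, hk, hx⟩
  · rintro ⟨k, -, hk⟩
    exact ⟨_, hk, fun i => Nat.le_of_lt_succ (Nat.mod_lt _ b.succ_pos)⟩

theorem primrec_part_boxPoint {s : ℤ → ℕ} (hs : Primrec s) :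
    Primrec fun q : ℕ × EqCode × ℕ => q.2.1.part s (boxPoint q.2.1.1 q.2.2 q.1) := by
  refine primrec_list_sum_map (f := fun q : ℕ × EqCode × ℕ => q.2.1.2)
    (g := fun q t => s t.1 * ∏ i : Fin q.2.1.1, boxPoint q.2.1.1 q.2.2 q.1 i ^ t.2.getD i 0)
    (Primrec.snd.comp (Primrec.fst.comp Primrec.snd)) ?_
  refine Primrec.nat_mul.comp (hs.comp (Primrec.fst.comp Primrec.snd)) ?_
  refine primrec_prod_fin (p := fun r : (ℕ × EqCode × ℕ) × (ℤ × List ℕ) => r.1.2.1.1)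
    (g := fun r i => (r.1.1 / (r.1.2.2 + 1) ^ i % (r.1.2.2 + 1)) ^ r.2.2.getD i 0)
    (Primrec.fst.comp (Primrec.fst.comp (Primrec.snd.comp Primrec.fst))) ?_
  have hb : Primrec fun v : ((ℕ × EqCode × ℕ) × (ℤ × List ℕ)) × ℕ => v.1.1.2.2 + 1 :=
    Primrec.succ.comp (Primrec.snd.comp (Primrec.snd.comp (Primrec.fst.comp Primrec.fst)))
  exact primrec_nat_pow.comp
    (Primrec.nat_mod.comp (Primrec.nat_div.comp (Primrec.fst.comp (Primrec.fst.comp Primrec.fst))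
      (primrec_nat_pow.comp hb Primrec.snd)) hb)
    ((Primrec.list_getD 0).comp (Primrec.snd.comp (Primrec.snd.comp Primrec.fst)) Primrec.snd)

/-- Solvability in a box is decided by a primitive recursive function. -/
theorem exists_primrec_solvableInBox : ∃ B : EqCode → ℕ → Bool, Primrec₂ B ∧
    ∀ c b, B c b = true ↔ SolvableInBox c b := by
  have h : PrimrecRel fun (k : ℕ) (q : EqCode × ℕ) =>
      q.1.part Int.toNat (boxPoint q.1.1 q.2 k) =
        q.1.part (fun z => (-z).toNat) (boxPoint q.1.1 q.2 k) :=
    Primrec.eq.comp (primrec_part_boxPoint primrec_int_toNat)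
      (primrec_part_boxPoint primrec_int_neg_toNat)
  obtain ⟨hdec, hprim⟩ := h.exists_mem_list.comp
    (f := fun q : EqCode × ℕ => List.range ((q.2 + 1) ^ q.1.1))
    (Primrec.list_range.comp (primrec_nat_pow.comp (Primrec.succ.comp Primrec.snd)
      (Primrec.fst.comp Primrec.fst)))
    (Primrec.id (α := EqCode × ℕ))
  refine ⟨fun c b => @decide _ (hdec (c, b)), hprim, fun c b => ?_⟩
  rw [decide_eq_true_iff, solvableInBox_iff]
  simp only [List.mem_range, id]

/-! ### Sections of a polynomial -/

/-- The codes of the polynomials `W(a, ·)` are computed from `a`. -/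
theorem exists_primrec_section {n m : ℕ} (W : MvPolynomial (Fin n ⊕ Fin m) ℤ) :
    ∃ F : (Fin n → ℕ) → List (ℤ × List ℕ), Primrec F ∧
      ∀ a (x : Fin m → ℕ), x ∈ Sol (EqCode.poly (m, F a)) ↔ Sum.elim a x ∈ Sol W := by
  suffices h : ∃ F : (Fin n → ℕ) → List (ℤ × List ℕ), Primrec F ∧ ∀ a (x : Fin m → ℕ),
      ((F a).map fun t => t.1 * ∏ i : Fin m, (x i : ℤ) ^ t.2.getD i 0).sum =
        MvPolynomial.eval (fun i => ((Sum.elim a x i : ℕ) : ℤ)) W by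
    obtain ⟨F, hF, h⟩ := h
    refine ⟨F, hF, fun a x => ?_⟩
    exact (mem_sol_poly_iff (m, F a) x).trans (iff_of_eq (congrArg (· = 0) (h a x)))
  induction W using MvPolynomial.monomial_add_induction_on with
  | C z => exact ⟨fun _ => [(z, [])], Primrec.const _, by simp⟩
  | monomial_add d z W _ _ ih =>
    obtain ⟨F, hF, h⟩ := ih
    have hN : ∀ s : Finset (Fin n), Primrec fun a : Fin n → ℕ => ∏ i ∈ s, a i ^ d (Sum.inl i) := by
      intro s
      induction s using Finset.induction_on with
      | empty => simpa using Primrec.const 1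
      | insert i s hi ih =>
        simp only [Finset.prod_insert hi]
        exact Primrec.nat_mul.comp (primrec_nat_pow.comp
          (Primrec.fin_app.comp Primrec.id (Primrec.const i)) (Primrec.const _)) ih
    let t : ℤ × List ℕ := (z, List.ofFn fun i => d (Sum.inr i))
    -- The monomial in `x` is repeated as many times as the value of the parameter part, which
    -- avoids multiplying integer coefficients.
    refine ⟨fun a => (List.range (∏ i, a i ^ d (Sum.inl i))).map (fun _ => t) ++ F a,
      Primrec.list_append.comp (Primrec.list_map (Primrec.list_range.comp (hN _))
        (Primrec.const t).to₂) hF, fun a x => ?_⟩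
    rw [List.map_append, List.sum_append, h, map_add, MvPolynomial.eval_monomial,
      Finsupp.prod_fintype _ _ (by simp), Fintype.prod_sum_type]
    simp [t, List.getD_eq_getElem?_getD]
    ring

theorem SolvabilityDecidable.computablePred {κ : Cardinal.{0}} (h : SolvabilityDecidable κ) {n : ℕ}
    {M : Set (Fin n → ℕ)} (hM : HasFoldRepresentation κ M) :
    ComputablePred (fun a : Fin n → ℕ => a ∈ M) := by
  obtain ⟨A, hA, hAD⟩ := h
  obtain ⟨m, W, hW, hcard⟩ := hM
  obtain ⟨F, hF, hFW⟩ := exists_primrec_section W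
  have hSol : ∀ a, Sol (EqCode.poly (m, F a)) = {x : Fin m → ℕ | Sum.elim a x ∈ Sol W} :=
    fun a => Set.ext (hFW a)
  rw [ComputablePred.computable_iff]
  refine ⟨fun a => A (m, F a), hA.comp (Primrec.pair (Primrec.const m) hF).to_comp,
    funext fun a => propext ?_⟩
  rw [hW, hAD (m, F a) (by rw [hSol]; exact hcard a), hSol]
  rfl

/-! ### Systems as single equations -/

/-- The exponents of the monomial `∏_{j ∈ l} x_j` in `n` unknowns. -/
def exponents (n : ℕ) (l : List ℕ) : List ℕ :=
  (List.range n).map fun i => (l.map fun j => if j = i then 1 else 0).sum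

theorem prod_pow_exponents {n : ℕ} (l : List (Fin n)) (x : Fin n → ℤ) :
    ∏ i : Fin n, x i ^ (exponents n (l.map Fin.val)).getD i 0 = (l.map x).prod := by
  induction l with
  | nil => simp [exponents, List.getD_eq_getElem?_getD]
  | cons j l ih =>
    simp only [exponents, List.getD_eq_getElem?_getD, List.map_cons, List.sum_cons,
      List.prod_cons] at ih ⊢
    rw [← ih]
    simp only [pow_add, List.getElem?_map, List.getElem?_range, Fin.is_lt, Option.map_some,
      Option.getD_some, Finset.prod_mul_distrib, Fin.val_inj]
    simp

theorem primrec_exponents : Primrec₂ exponents := by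
  refine Primrec.list_map (Primrec.list_range.comp Primrec.fst) ?_
  refine primrec_list_sum_map (f := fun r : (ℕ × List ℕ) × ℕ => r.1.2)
    (g := fun r j => if j = r.2 then 1 else 0) (Primrec.snd.comp Primrec.fst) ?_
  exact Primrec.ite (Primrec.eq.comp Primrec.snd (Primrec.snd.comp Primrec.fst))
    (Primrec.const 1) (Primrec.const 0)

/-- The number of an equation of `E_n`. -/
def E.num {n : ℕ} : E n → ℕ
  | .one k => Nat.pair 0 (Nat.pair k (Nat.pair 0 0))
  | .add i j k => Nat.pair 1 (Nat.pair i (Nat.pair j k))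
  | .mul i j k => Nat.pair 2 (Nat.pair i (Nat.pair j k))

/-- A bound for the numbers of the equations of `E_n`. -/
def numBound (n : ℕ) : ℕ := Nat.pair 3 (Nat.pair n (Nat.pair n n))

theorem pair_lt_pair {a b c d : ℕ} (h : a < c) (h' : b ≤ d) : Nat.pair a b < Nat.pair c d := by
  rcases h'.eq_or_lt with rfl | h'
  · exact Nat.pair_lt_pair_left _ h
  · exact (Nat.pair_lt_pair_left _ h).trans (Nat.pair_lt_pair_right _ h')

theorem E.num_lt {n : ℕ} (e : E n) : e.num < numBound n := by
  rcases e with k | ⟨i, j, k⟩ | ⟨i, j, k⟩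
  · exact pair_lt_pair (by norm_num) (pair_lt_pair k.2
      ((pair_lt_pair k.pos k.pos.le).le)).le
  · exact pair_lt_pair (by norm_num) (pair_lt_pair i.2 (pair_lt_pair j.2 k.2.le).le).le
  · exact pair_lt_pair (by norm_num) (pair_lt_pair i.2 (pair_lt_pair j.2 k.2.le).le).le

/-- The monomials of the square of the difference of the two sides of the equation with the
number `e`. -/
def squareTerms (n e : ℕ) : List (ℤ × List ℕ) :=
  let t := e.unpair.1
  let i := e.unpair.2.unpair.1
  let j := e.unpair.2.unpair.2.unpair.1
  let k := e.unpair.2.unpair.2.unpair.2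
  if t = 0 then
    [(1, exponents n [i, i]), (-2, exponents n [i]), (1, exponents n [])]
  else if t = 1 then
    [(1, exponents n [i, i]), (1, exponents n [j, j]), (1, exponents n [k, k]),
      (2, exponents n [i, j]), (-2, exponents n [i, k]), (-2, exponents n [j, k])]
  else
    [(1, exponents n [i, j, i, j]), (-2, exponents n [i, j, k]), (1, exponents n [k, k])]

theorem primrec_squareTerms : Primrec₂ squareTerms := by
  have ht : Primrec fun p : ℕ × ℕ => p.2.unpair.1 :=
    Primrec.fst.comp (Primrec.unpair.comp Primrec.snd)
  have hr : Primrec fun p : ℕ × ℕ => p.2.unpair.2.unpair :=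
    Primrec.unpair.comp (Primrec.snd.comp (Primrec.unpair.comp Primrec.snd))
  have hr' : Primrec fun p : ℕ × ℕ => p.2.unpair.2.unpair.2.unpair :=
    Primrec.unpair.comp (Primrec.snd.comp hr)
  have hi := Primrec.fst.comp hr
  have hj := Primrec.fst.comp hr'
  have hk := Primrec.snd.comp hr'
  have hT : ∀ (z : ℤ) {l : ℕ × ℕ → List ℕ}, Primrec l →
      Primrec fun p : ℕ × ℕ => (z, exponents p.1 (l p)) := fun z l hl =>
    Primrec.pair (Primrec.const z) (primrec_exponents.comp Primrec.fst hl)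
  have hnil : ∀ {γ : Type} [Primcodable γ], Primrec fun _ : ℕ × ℕ => ([] : List γ) :=
    Primrec.const []
  have hc : ∀ {γ : Type} [Primcodable γ] {g : ℕ × ℕ → γ} {l : ℕ × ℕ → List γ},
      Primrec g → Primrec l → Primrec fun p => g p :: l p :=
    fun hg hl => Primrec.list_cons.comp hg hl
  refine Primrec.ite (Primrec.eq.comp ht (Primrec.const 0)) ?_
    (Primrec.ite (Primrec.eq.comp ht (Primrec.const 1)) ?_ ?_)
  · exact hc (hT 1 (hc hi (hc hi hnil))) (hc (hT (-2) (hc hi hnil)) (hc (hT 1 hnil) hnil))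
  · exact hc (hT 1 (hc hi (hc hi hnil))) (hc (hT 1 (hc hj (hc hj hnil)))
      (hc (hT 1 (hc hk (hc hk hnil))) (hc (hT 2 (hc hi (hc hj hnil)))
      (hc (hT (-2) (hc hi (hc hk hnil))) (hc (hT (-2) (hc hj (hc hk hnil))) hnil)))))
  · exact hc (hT 1 (hc hi (hc hj (hc hi (hc hj hnil)))))
      (hc (hT (-2) (hc hi (hc hj (hc hk hnil)))) (hc (hT 1 (hc hk (hc hk hnil))) hnil))

/-- The difference of the two sides of an equation. -/
def E.defect {n : ℕ} (x : Fin n → ℕ) : E n → ℤ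
  | .one k => x k - 1
  | .add i j k => x i + x j - x k
  | .mul i j k => x i * x j - x k

theorem E.defect_eq_zero_iff {n : ℕ} (x : Fin n → ℕ) (e : E n) : e.defect x = 0 ↔ e.Holds x := by
  rcases e with k | ⟨i, j, k⟩ | ⟨i, j, k⟩ <;> simp only [E.defect, E.Holds, sub_eq_zero] <;>
    norm_cast

theorem sum_squareTerms {n : ℕ} (x : Fin n → ℕ) (e : E n) :
    ((squareTerms n e.num).map fun t => t.1 * ∏ i : Fin n, (x i : ℤ) ^ t.2.getD i 0).sum =
      e.defect x ^ 2 := by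
  have h (l : List (Fin n)) := prod_pow_exponents l fun i => (x i : ℤ)
  rcases e with k | ⟨i, j, k⟩ | ⟨i, j, k⟩
  · have h1 := h [k, k]
    have h2 := h [k]
    have h3 := h []
    simp only [List.map_cons, List.map_nil] at h1 h2 h3
    simp only [squareTerms, E.num, Nat.unpair_pair, if_true, List.map_cons, List.map_nil, h1, h2,
      h3, E.defect]
    simp
    ring
  · have h1 := h [i, i]
    have h2 := h [j, j]
    have h3 := h [k, k]
    have h4 := h [i, j]
    have h5 := h [i, k]
    have h6 := h [j, k]
    simp only [List.map_cons, List.map_nil] at h1 h2 h3 h4 h5 h6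
    simp only [squareTerms, E.num, Nat.unpair_pair, if_true, one_ne_zero, if_false, List.map_cons,
      List.map_nil, h1, h2, h3, h4, h5, h6, E.defect]
    simp
    ring
  · have h1 := h [i, j, i, j]
    have h2 := h [i, j, k]
    have h3 := h [k, k]
    simp only [List.map_cons, List.map_nil] at h1 h2 h3
    simp only [squareTerms, E.num, Nat.unpair_pair, OfNat.ofNat_ne_zero, OfNat.ofNat_ne_one,
      if_false, List.map_cons, List.map_nil, h1, h2, h3, E.defect]
    simp
    ring

/-- The sum of the squares of the equations whose numbers are the positions of the binary digits
`1` of `s`, as an equation in `n` unknowns. -/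
def systemCode (n s : ℕ) : EqCode :=
  (n, (List.range (numBound n)).flatMap fun e =>
    if s / 2 ^ e % 2 = 1 then squareTerms n e else [])

theorem primrec_numBound : Primrec numBound :=
  Primrec₂.natPair.comp (Primrec.const 3)
    (Primrec₂.natPair.comp Primrec.id (Primrec₂.natPair.comp Primrec.id Primrec.id))

theorem primrec_systemCode : Primrec₂ systemCode := by
  refine Primrec.pair Primrec.fst (Primrec.list_flatMap
    (Primrec.list_range.comp (primrec_numBound.comp Primrec.fst)) ?_)
  refine Primrec.ite (Primrec.eq.comp (Primrec.nat_mod.comp (Primrec.nat_div.comp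
    (Primrec.snd.comp Primrec.fst) (primrec_nat_pow.comp (Primrec.const 2) Primrec.snd))
    (Primrec.const 2)) (Primrec.const 1))
    (primrec_squareTerms.comp (Primrec.fst.comp Primrec.fst) Primrec.snd) (Primrec.const [])

theorem sum_map_flatMap {α β : Type} (L : List α) (F : α → List β) (v : β → ℤ) :
    ((L.flatMap F).map v).sum = (L.map fun a => ((F a).map v).sum).sum := by
  induction L with
  | nil => rfl
  | cons a L ih => simp [ih]

theorem exists_sol_systemCode_eq {n : ℕ} (S : Set (E n)) :
    ∃ s < 2 ^ numBound n, Sol (systemCode n s).poly = SysSol S := by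
  classical
  -- The binary digits of `s` are the indicator of the numbers of the equations in `S`; numbers that
  -- encode no equation get digit `0`.
  obtain ⟨s, hs, hbit⟩ := exists_boxPoint_eq (p := numBound n) (b := 1)
    (x := fun e => if (e : ℕ) ∈ E.num '' S then 1 else 0) (fun i => by split <;> simp)
  refine ⟨s, hs, Set.ext fun (x : Fin n → ℕ) => ?_⟩
  have hbit' : ∀ e < numBound n, s / 2 ^ e % 2 = 1 ↔ e ∈ E.num '' S := fun e he => by
    have := congrFun hbit ⟨e, he⟩
    simp only [boxPoint] at this
    rw [show (1 + 1 : ℕ) = 2 from rfl] at this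
    rw [this]
    simp
  have hterm : ∀ e : E n, e ∈ S →
      (((if s / 2 ^ e.num % 2 = 1 then squareTerms n e.num else []).map
        fun t => t.1 * ∏ i : Fin n, (x i : ℤ) ^ t.2.getD i 0).sum = e.defect x ^ 2) := by
    intro e he
    rw [if_pos ((hbit' _ e.num_lt).2 ⟨e, he, rfl⟩), sum_squareTerms]
  have hzero : ∀ k < numBound n, k ∉ E.num '' S →
      (((if s / 2 ^ k % 2 = 1 then squareTerms n k else []).map
        fun t => t.1 * ∏ i : Fin n, (x i : ℤ) ^ t.2.getD i 0).sum = 0) := by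
    intro k hk hkS
    rw [if_neg fun h => hkS ((hbit' k hk).1 h)]
    rfl
  have hsum := sum_map_flatMap (List.range (numBound n))
    (fun e => if s / 2 ^ e % 2 = 1 then squareTerms n e else [])
    (fun t => t.1 * ∏ i : Fin n, (x i : ℤ) ^ t.2.getD i 0)
  refine (mem_sol_poly_iff (systemCode n s) x).trans ?_
  change (List.map _ (List.flatMap _ _)).sum = 0 ↔ _
  refine (iff_of_eq (congrArg (· = 0) hsum)).trans ?_
  change ∑ k ∈ Finset.range (numBound n), _ = 0 ↔ _
  rw [Finset.sum_eq_zero_iff_of_nonneg]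
  · constructor
    · intro h e he
      rw [← E.defect_eq_zero_iff, ← sq_eq_zero_iff, ← hterm e he]
      exact h _ (Finset.mem_range.2 e.num_lt)
    · intro h k hk
      by_cases hkS : k ∈ E.num '' S
      · obtain ⟨e, he, rfl⟩ := hkS
        rw [hterm e he, sq_eq_zero_iff, E.defect_eq_zero_iff]
        exact h e he
      · exact hzero k (Finset.mem_range.1 hk) hkS
  · intro k hk
    by_cases hkS : k ∈ E.num '' S
    · obtain ⟨e, he, rfl⟩ := hkS
      rw [hterm e he]
      positivity
    · exact (hzero k (Finset.mem_range.1 hk) hkS).ge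

/-! ### From the algorithm to a computable majorant. -/

theorem SolvabilityDecidable.majorized {κ : Cardinal.{0}} (hκ : 2 ≤ κ)
    (h : SolvabilityDecidable κ) : MajorizedByComputable (f κ) := by
  obtain ⟨A, hA, hAD⟩ := h
  obtain ⟨B, hB, hBox⟩ := exists_primrec_solvableInBox
  have hA_sound : ∀ c, A c = true → (Sol c.poly).Nonempty := fun c hc => by
    by_contra hne
    have h0 : #(Sol c.poly) < κ := by
      rw [Set.not_nonempty_iff_eq_empty.1 hne, Cardinal.mk_eq_zero]
      exact lt_of_lt_of_le (by norm_num) hκ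
    exact hne ((hAD c h0).1 hc)
  obtain ⟨g, hg, hgA⟩ := exists_computable_search
    -- After a NO the search stops at once, so `g` is total even on equations with `κ` or more
    -- solutions, where NO may be wrong.
    (p := fun (c : EqCode) b => !A c || B c b)
    (Primrec.or.to_comp.comp (Primrec.not.to_comp.comp (hA.comp Computable.fst)) hB.to_comp)
    (fun c => by
      by_cases hc : A c = true
      · obtain ⟨x, hx⟩ := hA_sound c hc
        exact ⟨∑ i, x i, by
          rw [Bool.or_eq_true, hBox]
          exact Or.inr ⟨x, hx, fun i =>
            Finset.single_le_sum (f := x) (fun _ _ => Nat.zero_le _) (Finset.mem_univ i)⟩⟩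
      · exact ⟨0, by simp [hc]⟩)
  refine ⟨fun n => ∑ s ∈ Finset.range (2 ^ numBound n), g (systemCode n s),
    computable_sum_range (hg.comp primrec_systemCode.to_comp)
      (primrec_nat_pow.comp (Primrec.const 2) primrec_numBound).to_comp,
    fun n _ => (f_isLeast κ n).2 fun S hS hcard => ?_⟩
  obtain ⟨s, hs, hSol⟩ := exists_sol_systemCode_eq S
  have hAs : A (systemCode n s) = true := (hAD _ (by rw [hSol]; exact hcard)).2 (by rwa [hSol])
  have hb := hgA (systemCode n s)
  simp only [hAs, Bool.not_true, Bool.false_or, hBox] at hb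
  obtain ⟨x, hx, hle⟩ := hb
  rw [hSol] at hx
  exact ⟨x, hx, fun i => (hle i).trans (Finset.single_le_sum
    (f := fun s => g (systemCode n s)) (fun _ _ => Nat.zero_le _) (Finset.mem_range.2 hs))⟩

/-! ### Definitions by systems with unique auxiliary values -/

/-- The condition is a conjunction of equations of the forms `x_k = 1`, `x_i + x_j = x_k`,
`x_i * x_j = x_k` in unknowns indexed by `σ`. -/
inductive IsSystem {σ : Type} : ((σ → ℕ) → Prop) → Prop
  | trivial : IsSystem fun _ => True
  | one (k : σ) : IsSystem fun w => w k = 1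
  | add (i j k : σ) : IsSystem fun w => w i + w j = w k
  | mul (i j k : σ) : IsSystem fun w => w i * w j = w k
  | and {P Q : (σ → ℕ) → Prop} : IsSystem P → IsSystem Q → IsSystem fun w => P w ∧ Q w

theorem IsSystem.comap {σ τ : Type} {P : (σ → ℕ) → Prop} (hP : IsSystem P) (h : σ → τ) :
    IsSystem fun w : τ → ℕ => P (w ∘ h) := by
  induction hP with
  | trivial => exact .trivial
  | one k => exact .one (h k)
  | add i j k => exact .add (h i) (h j) (h k)
  | mul i j k => exact .mul (h i) (h j) (h k)
  | and _ _ ihP ihQ => exact ihP.and ihQ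

theorem IsSystem.exists_sysSol_eq {n : ℕ} {P : (Fin n → ℕ) → Prop} (hP : IsSystem P) :
    ∃ S : Set (E n), ∀ x, x ∈ SysSol S ↔ P x := by
  induction hP with
  | trivial => exact ⟨∅, by simp [SysSol]⟩
  | one k => exact ⟨{.one k}, by simp [SysSol, E.Holds]⟩
  | add i j k => exact ⟨{.add i j k}, by simp [SysSol, E.Holds]⟩
  | mul i j k => exact ⟨{.mul i j k}, by simp [SysSol, E.Holds]⟩
  | and _ _ ihP ihQ =>
    obtain ⟨S, hS⟩ := ihP
    obtain ⟨T, hT⟩ := ihQ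
    refine ⟨S ∪ T, fun x => ?_⟩
    refine Iff.trans ?_ (and_congr (hS x) (hT x))
    exact ⟨fun h => ⟨fun e he => h e (.inl he), fun e he => h e (.inr he)⟩,
      fun h e he => he.elim (h.1 e) (h.2 e)⟩

/-- The function `F` is defined by a system with `N` auxiliary unknowns whose values are uniquely
determined by the arguments. -/
def DefinableBySystem {σ : Type} (N : ℕ) (F : (σ → ℕ) → ℕ) : Prop :=
  ∃ (ι : Type) (_ : Fintype ι) (P : (σ ⊕ ι → ℕ) → Prop) (r : σ ⊕ ι) (y : (σ → ℕ) → ι → ℕ),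
    Fintype.card ι = N ∧ IsSystem P ∧ (∀ x z, P (Sum.elim x z) ↔ z = y x) ∧
      ∀ x, Sum.elim x (y x) r = F x

namespace DefinableBySystem

variable {σ : Type} {N M : ℕ} {F G : (σ → ℕ) → ℕ}

theorem var (i : σ) : DefinableBySystem 0 fun x : σ → ℕ => x i :=
  ⟨Empty, inferInstance, _, .inl i, fun _ => Empty.elim, rfl, .trivial,
    fun _ _ => ⟨fun _ => Subsingleton.elim _ _, fun _ => True.intro⟩, fun _ => rfl⟩

theorem zero : DefinableBySystem 1 fun _ : σ → ℕ => 0 :=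
  ⟨Unit, inferInstance, _, .inr (), fun _ _ => 0, rfl, .add (.inr ()) (.inr ()) (.inr ()),
    fun x z => by simp [funext_iff, Unique.forall_iff], fun _ => rfl⟩

theorem one : DefinableBySystem 1 fun _ : σ → ℕ => 1 :=
  ⟨Unit, inferInstance, _, .inr (), fun _ _ => 1, rfl, .one (.inr ()),
    fun x z => by simp [funext_iff, Unique.forall_iff], fun _ => rfl⟩

/-- The two sets of auxiliary unknowns are kept disjoint and one unknown is added for the result, so
uniqueness is inherited and the count is exact. -/
theorem op (hF : DefinableBySystem N F) (hG : DefinableBySystem M G) (f : ℕ → ℕ → ℕ)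
    (hf : ∀ {τ : Type} (i j k : τ), IsSystem fun w : τ → ℕ => f (w i) (w j) = w k) :
    DefinableBySystem (N + M + 1) fun x => f (F x) (G x) := by
  obtain ⟨ι, _, P, r, y, hN, hP, hPy, hr⟩ := hF
  obtain ⟨κ, _, Q, s, z, hM, hQ, hQz, hs⟩ := hG
  let g : σ ⊕ ι → σ ⊕ ((ι ⊕ κ) ⊕ Unit) := Sum.map id (Sum.inl ∘ Sum.inl)
  let h : σ ⊕ κ → σ ⊕ ((ι ⊕ κ) ⊕ Unit) := Sum.map id (Sum.inl ∘ Sum.inr)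
  have hg (x : σ → ℕ) (w : (ι ⊕ κ) ⊕ Unit → ℕ) :
      Sum.elim x w ∘ g = Sum.elim x fun i => w (.inl (.inl i)) := by
    funext i; rcases i with i | i <;> rfl
  have hh (x : σ → ℕ) (w : (ι ⊕ κ) ⊕ Unit → ℕ) :
      Sum.elim x w ∘ h = Sum.elim x fun i => w (.inl (.inr i)) := by
    funext i; rcases i with i | i <;> rfl
  refine ⟨(ι ⊕ κ) ⊕ Unit, inferInstance, _, .inr (.inr ()),
    fun x => Sum.elim (Sum.elim (y x) (z x)) fun _ => f (F x) (G x), by simp [hN, hM],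
    (hP.comap g).and ((hQ.comap h).and (hf (g r) (h s) (.inr (.inr ())))), fun x w => ?_,
    fun x => rfl⟩
  rw [hg, hh, hPy, hQz]
  have e1 : Sum.elim x w (g r) = Sum.elim x (fun i => w (.inl (.inl i))) r := congrFun (hg x w) r
  have e2 : Sum.elim x w (h s) = Sum.elim x (fun i => w (.inl (.inr i))) s := congrFun (hh x w) s
  rw [e1, e2]
  constructor
  · rintro ⟨h1, h2, h3⟩
    rw [h1, h2, hr, hs] at h3
    funext i
    rcases i with (i | i) | i
    · exact congrFun h1 i
    · exact congrFun h2 i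
    · exact h3.symm
  · rintro rfl
    exact ⟨rfl, rfl, by simp only [Sum.elim_inl, Sum.elim_inr, hr, hs]⟩

theorem add (hF : DefinableBySystem N F) (hG : DefinableBySystem M G) :
    DefinableBySystem (N + M + 1) fun x => F x + G x := hF.op hG _ .add

theorem mul (hF : DefinableBySystem N F) (hG : DefinableBySystem M G) :
    DefinableBySystem (N + M + 1) fun x => F x * G x := hF.op hG _ .mul

/-- Each successor costs two unknowns: a fresh `1` and the sum. -/
theorem const (c : ℕ) : DefinableBySystem (2 * c + 1) fun _ : σ → ℕ => c := by
  induction c with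
  | zero => exact zero
  | succ c ih => exact ih.add one

theorem var_pow (i : σ) (e : ℕ) : DefinableBySystem (e + 1) fun x : σ → ℕ => x i ^ e := by
  induction e with
  | zero => simpa using one (σ := σ)
  | succ e ih => simpa only [pow_succ] using ih.mul (var i)

theorem prod {ι : Type} (s : Finset ι) {n : ι → ℕ} {H : ι → (σ → ℕ) → ℕ}
    (hH : ∀ i, DefinableBySystem (n i) (H i)) :
    DefinableBySystem (∑ i ∈ s, (n i + 1) + 1) fun x => ∏ i ∈ s, H i x := by
  classical
  induction s using Finset.induction_on with
  | empty => simpa using one (σ := σ)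
  | insert i s hi ih =>
    simp only [Finset.prod_insert hi, Finset.sum_insert hi]
    convert (hH i).mul ih using 1
    ring

theorem list_sum {ι : Type} (L : List ι) {n : ι → ℕ} {H : ι → (σ → ℕ) → ℕ}
    (hH : ∀ i, DefinableBySystem (n i) (H i)) :
    DefinableBySystem ((L.map fun i => n i + 1).sum + 1) fun x => (L.map fun i => H i x).sum := by
  induction L with
  | nil => exact zero
  | cons i L ih =>
    simp only [List.map_cons, List.sum_cons]
    convert (hH i).add ih using 1
    ring

end DefinableBySystem

/-! ### From an equation to an equivalent system. -/

/-- The number of auxiliary unknowns in the definition of `EqCode.part`. -/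
def EqCode.partSize (s : ℤ → ℕ) (c : EqCode) : ℕ :=
  (c.2.map fun t => ((2 * s t.1 + 1) +
    (∑ i : Fin c.1, (t.2.getD i 0 + 1 + 1) + 1) + 1) + 1).sum + 1

theorem EqCode.definableBySystem_part (s : ℤ → ℕ) (c : EqCode) :
    DefinableBySystem (c.partSize s) (c.part s) :=
  .list_sum c.2 fun _ => (DefinableBySystem.const _).mul (.prod _ fun i => .var_pow i _)

theorem EqCode.primrec_partSize {s : ℤ → ℕ} (hs : Primrec s) : Primrec (EqCode.partSize s) := by
  refine Primrec.succ.comp (primrec_list_sum_map (f := fun c : EqCode => c.2)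
    (g := fun c t => ((2 * s t.1 + 1) + (∑ i : Fin c.1, (t.2.getD i 0 + 1 + 1) + 1) + 1) + 1)
    Primrec.snd ?_)
  refine Primrec.succ.comp (Primrec.succ.comp (Primrec.nat_add.comp (Primrec.nat_double_succ.comp
    (hs.comp (Primrec.fst.comp Primrec.snd))) (Primrec.succ.comp ?_)))
  exact primrec_sum_fin (p := fun q : EqCode × (ℤ × List ℕ) => q.1.1)
    (g := fun q i => q.2.2.getD i 0 + 1 + 1) (Primrec.fst.comp Primrec.fst)
    (Primrec.succ.comp (Primrec.succ.comp ((Primrec.list_getD 0).comp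
      (Primrec.snd.comp (Primrec.snd.comp Primrec.fst)) Primrec.snd)))

/-- The number of unknowns of a system that is equivalent to an equation. -/
def EqCode.systemSize (c : EqCode) : ℕ :=
  c.1 + (c.partSize Int.toNat + c.partSize (fun z => (-z).toNat) + 1)

theorem EqCode.primrec_systemSize : Primrec EqCode.systemSize :=
  Primrec.nat_add.comp Primrec.fst (Primrec.succ.comp (Primrec.nat_add.comp
    (EqCode.primrec_partSize primrec_int_toNat) (EqCode.primrec_partSize primrec_int_neg_toNat)))

/-- Every equation is equivalent to a system of a computable number of unknowns: its solutions are
restrictions of the solutions of the system, and extend uniquely to them. -/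
theorem EqCode.exists_system (c : EqCode) :
    ∃ (S : Set (E c.systemSize)) (h : Fin c.1 → Fin c.systemSize),
      Set.BijOn (fun w => w ∘ h) (SysSol S) (Sol c.poly) := by
  obtain ⟨ι, _, P, r, y, hN, hP, hPy, hr⟩ := c.definableBySystem_part Int.toNat
  obtain ⟨κ, _, Q, s, z, hM, hQ, hQz, hs⟩ := c.definableBySystem_part fun z => (-z).toNat
  let τ : Type := Fin c.1 ⊕ ((ι ⊕ κ) ⊕ Unit)
  let e : τ ≃ Fin c.systemSize := Fintype.equivFinOfCardEq (by
    simp [τ, hN, hM, EqCode.systemSize])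
  let g : Fin c.1 ⊕ ι → τ := Sum.map id (Sum.inl ∘ Sum.inl)
  let h : Fin c.1 ⊕ κ → τ := Sum.map id (Sum.inl ∘ Sum.inr)
  -- No equation of `E_n` reads `x_i = x_j`; the extra unknown `o`, forced to be `0` by `o + o = o`,
  -- allows equality of the two parts to be stated as `r + o = s`.
  let o : τ := .inr (.inr ())
  have hsys := (((hP.comap g).and (hQ.comap h)).and
    ((IsSystem.add o o o).and (.add (g r) o (h s)))).comap e
  obtain ⟨S, hS⟩ := hsys.exists_sysSol_eq
  have hg (v : τ → ℕ) : v ∘ g = Sum.elim (v ∘ .inl) fun i => v (.inr (.inl (.inl i))) := by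
    funext i; rcases i with i | i <;> rfl
  have hh (v : τ → ℕ) : v ∘ h = Sum.elim (v ∘ .inl) fun i => v (.inr (.inl (.inr i))) := by
    funext i; rcases i with i | i <;> rfl
  -- The system holds exactly when the restriction solves the equation and all other coordinates are
  -- the prescribed functions of it; the bijection follows.
  have key (v : τ → ℕ) : ((P (v ∘ g) ∧ Q (v ∘ h)) ∧ (v o + v o = v o ∧ v (g r) + v o = v (h s))) ↔
      v ∘ .inl ∈ Sol c.poly ∧
        v = Sum.elim (v ∘ .inl) (Sum.elim (Sum.elim (y (v ∘ .inl)) (z (v ∘ .inl))) fun _ => 0) := by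
    have e1 : v (g r) = Sum.elim (v ∘ .inl) (fun i => v (.inr (.inl (.inl i)))) r :=
      congrFun (hg v) r
    have e2 : v (h s) = Sum.elim (v ∘ .inl) (fun i => v (.inr (.inl (.inr i)))) s :=
      congrFun (hh v) s
    rw [hg, hh, hPy, hQz, e1, e2, mem_sol_poly_iff_part, ← hr, ← hs]
    constructor
    · rintro ⟨⟨h1, h2⟩, h3, h4⟩
      have h0 : v o = 0 := by omega
      rw [h1, h2, h0, add_zero] at h4
      refine ⟨h4, funext fun i => ?_⟩
      rcases i with i | (i | i) | i
      · rfl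
      · exact congrFun h1 i
      · exact congrFun h2 i
      · exact h0
    · rintro ⟨h1, h2⟩
      have h3 : (fun i => v (.inr (.inl (.inl i)))) = y (v ∘ .inl) :=
        funext fun i => congrFun h2 (.inr (.inl (.inl i)))
      have h4 : (fun i => v (.inr (.inl (.inr i)))) = z (v ∘ .inl) :=
        funext fun i => congrFun h2 (.inr (.inl (.inr i)))
      have h0 : v o = 0 := congrFun h2 o
      exact ⟨⟨h3, h4⟩, by omega, by rw [h3, h4, h0, h1, add_zero]⟩
  refine ⟨S, fun i => e (.inl i), fun w hw => ?_, fun w hw w' hw' hww' => ?_, fun x hx => ?_⟩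
  · exact ((key (w ∘ e)).1 ((hS w).1 hw)).1
  · have h1 := ((key (w ∘ e)).1 ((hS w).1 hw)).2
    have h2 := ((key (w' ∘ e)).1 ((hS w').1 hw')).2
    have h3 : (w ∘ e) ∘ Sum.inl = (w' ∘ e) ∘ Sum.inl := hww'
    rw [h3, ← h2] at h1
    exact (e.surjective.injective_comp_right) h1
  · refine ⟨Sum.elim x (Sum.elim (Sum.elim (y x) (z x)) fun _ => 0) ∘ e.symm,
      (hS _).2 ((key _).2 ?_), ?_⟩
    · rw [Function.comp_assoc _ e.symm e, e.symm_comp_self]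
      exact ⟨hx, rfl⟩
    · funext i
      simp

theorem MajorizedByComputable.solvabilityDecidable {κ : Cardinal.{0}}
    (h : MajorizedByComputable (f κ)) : SolvabilityDecidable κ := by
  obtain ⟨g, hg, hfg⟩ := h
  obtain ⟨B, hB, hBox⟩ := exists_primrec_solvableInBox
  refine ⟨fun c => B c (g c.systemSize), hB.to_comp.comp Computable.id
    (hg.comp EqCode.primrec_systemSize.to_comp), fun c hc => ?_⟩
  rw [hBox]
  refine ⟨fun ⟨x, hx, _⟩ => ⟨x, hx⟩, fun hne => ?_⟩
  obtain ⟨S, h, hS⟩ := c.exists_system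
  have hcard : #(SysSol S) = #(Sol c.poly) := Cardinal.mk_congr (Set.BijOn.equiv _ hS)
  obtain ⟨x, hx⟩ := hne
  obtain ⟨w, hw, -⟩ := hS.surjOn hx
  obtain ⟨v, hv, hle⟩ := (f_isLeast κ c.systemSize).1 S ⟨w, hw⟩ (by rwa [hcard])
  -- Majorization is only assumed for positive arguments; the size is positive because of the
  -- unknown fixed at `0`.
  exact ⟨v ∘ h, hS.mapsTo hv, fun i => (hle _).trans (hfg _ (by unfold EqCode.systemSize; omega))⟩

end FoldDioph

theorem theorem2 (κ : Cardinal.{0}) (hκ : 2 ≤ κ) (hκω : κ ≤ Cardinal.aleph0) :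
    (FoldDioph.SolvabilityDecidable κ ↔ FoldDioph.MajorizedByComputable (FoldDioph.f κ)) ∧
    (FoldDioph.SolvabilityDecidable κ →
      ∀ (n : ℕ) (M : Set (Fin n → ℕ)), FoldDioph.HasFoldRepresentation κ M →
        ComputablePred (fun a : Fin n → ℕ => a ∈ M)) := by
  exact ⟨⟨fun h => h.majorized hκ, fun h => h.solvabilityDecidable⟩,
    fun h _ _ hM => h.computablePred hM⟩
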